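/- Let $\mathcal V$ be the convex set of nonnegative real arrays $V=(V_{nk})$, $n=1,2,\dots$, $0\le k\le n-1$, which satisfy the dual Eulerian recursion $$V_{nk}=(k+1)\,V_{n+1,k}+(n-k)\,V_{n+1,k+1}\qquad(n\ge 1,\ 0\le k\le n-1)$$ and the normalization $V_{10}=1$. Let $\mathrm{ex}(\mathcal V)$ be its set of extreme points, and let $$\Theta=\Big\{\tfrac{\varkappa}{2(\varkappa+1)}:\varkappa=0,1,2,\dots\Big\}\cup\Big\{\tfrac12\Big\}\cup\Big\{\tfrac{\varkappa+2}{2(\varkappa+1)}:\varkappa=0,1,2,\dots\Big\}.$$ Then $W\mapsto W_{20}$ is a bijection from $\mathrm{ex}(\mathcal V)$ onto $\Theta$, and, writing $W(\theta)$ for the extreme solution with $W_{20}(\theta)=\theta$ for $\theta\in\Theta$, one has for all $n\ge 1$ and $0\le k\le n-1$: 1. if $\theta=\frac{\varkappa+2}{2(\varkappa+1)}>\frac12$ with $\varkappa\in\{0,1,2,\dots\}$, then $W_{nk}(\theta)=\binom{n+\varkappa-k}{n}\big/(\varkappa+1)^n$; 2. if $\theta=\frac{\varkappa}{2(\varkappa+1)}<\frac12$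 with $\varkappa\in\{0,1,2,\dots\}$, then $W_{nk}(\theta)=\binom{\varkappa+k+1}{n}\big/(\varkappa+1)^n$; 3. if $\theta=\frac12$, then $W_{nk}(\theta)=\frac1{n!}$. In unified form, for every $\theta\in\Theta$, $$W_{nk}(\theta)=\frac1{n!}\prod_{i=-k}^{-k+n-1}\bigl(1+(2\theta-1)\,i\bigr).$$ -/

import Mathlib

namespace EulerianBoundary

/-- Real triangular arrays `V n k`, indexed by `n` and `0 ≤ k ≤ n - 1`; the row `n = 0` is empty. -/
abbrev Arr : Type := (n : ℕ) → Fin n → ℝ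

/-- The set of nonnegative solutions of the dual recursion
`V n k = (k + 1) * V (n + 1) k + (n - k) * V (n + 1) (k + 1)`, for `0 ≤ k ≤ n - 1`,
normalized by `V 1 0 = 1`. -/
def solutions : Set Arr :=
  {V | (∀ (n : ℕ) (k : Fin n), 0 ≤ V n k) ∧
    (∀ (n : ℕ) (k : Fin n),
      V n k = ((k : ℝ) + 1) * V (n + 1) k.castSucc + ((n : ℝ) - (k : ℝ)) * V (n + 1) k.succ) ∧
    V 1 0 = 1}

/-- The boundary: the extreme points of the convex set of solutions. -/
def boundary : Set Arr := Set.extremePoints ℝ solutions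

/-- The parameter set `{κ / (2 (κ + 1))} ∪ {1 / 2} ∪ {(κ + 2) / (2 (κ + 1))}`, `κ = 0, 1, 2, …`. -/
def parameters : Set ℝ :=
  Set.range (fun κ : ℕ => (κ : ℝ) / (2 * ((κ : ℝ) + 1))) ∪ {1 / 2} ∪
    Set.range (fun κ : ℕ => ((κ : ℝ) + 2) / (2 * ((κ : ℝ) + 1)))

end EulerianBoundary

namespace EulerianBoundary

open Finset

/-! The operator `difference`, call it D, commutes with the recursion, and (V + DV)/2 and (V - DV)/2
are again nonnegative solutions. They sum to V, so on an extreme V they are multiples of V: DV = yV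
with y = 2 V₂₀ - 1. This eigenvalue equation and the recursion determine every row from the previous
one, so V is the product array with parameter y. Its nonnegativity forces y = 0 or y = ±1/(κ+1).

Conversely, let Q_y(V) be the root entry of (D - y)²V, which is linear in V. At an extreme solution
it is the square of (eigenvalue - y), and Krein–Milman carries a variance estimate from extreme
solutions to all: Q_y ≥ 0, with equality only at the product array. That array is thus the unique
minimizer of a linear functional, hence extreme. -/

/-! ### Product solutions and their nonnegativity -/

/-- The product `(1 / n!) ∏ (1 + i y)` over the integers `-k ≤ i < n - k`. -/
noncomputable def productArray (y : ℝ) (n k : ℕ) : ℝ :=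
  1 / (n.factorial : ℝ) * ∏ j ∈ range n, (1 + ((j : ℝ) - k) * y)

theorem productArray_succ (y : ℝ) (n k : ℕ) :
    productArray y (n + 1) k = productArray y n k * (1 + ((n : ℝ) - k) * y) / ((n : ℝ) + 1) := by
  have hf : (n.factorial : ℝ) ≠ 0 := by positivity
  have hn : (n : ℝ) + 1 ≠ 0 := by positivity
  rw [productArray, productArray, prod_range_succ, Nat.factorial_succ, Nat.cast_mul, Nat.cast_succ]
  generalize ∏ j ∈ range n, (1 + ((j : ℝ) - k) * y) = P
  field_simp

theorem productArray_succ_succ (y : ℝ) (n k : ℕ) :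
    productArray y (n + 1) (k + 1) =
      productArray y n k * (1 - ((k : ℝ) + 1) * y) / ((n : ℝ) + 1) := by
  have hf : (n.factorial : ℝ) ≠ 0 := by positivity
  have hn : (n : ℝ) + 1 ≠ 0 := by positivity
  have h : ∏ j ∈ range n, (1 + (((j + 1 : ℕ) : ℝ) - ((k + 1 : ℕ) : ℝ)) * y) =
      ∏ j ∈ range n, (1 + ((j : ℝ) - k) * y) :=
    prod_congr rfl fun j _ => by push_cast; ring
  rw [productArray, productArray, prod_range_succ', h, Nat.factorial_succ, Nat.cast_mul,
    Nat.cast_succ]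
  generalize ∏ j ∈ range n, (1 + ((j : ℝ) - k) * y) = P
  push_cast
  field_simp
  ring

theorem productArray_one_zero (y : ℝ) : productArray y 1 0 = 1 := by
  simp [productArray]

theorem productArray_two_zero (y : ℝ) : productArray y 2 0 = (1 + y) / 2 := by
  simp [productArray, prod_range_succ]
  ring

theorem productArray_recursion (y : ℝ) (n k : ℕ) :
    productArray y n k = ((k : ℝ) + 1) * productArray y (n + 1) k +
      ((n : ℝ) - k) * productArray y (n + 1) (k + 1) := by
  have hn : (n : ℝ) + 1 ≠ 0 := by positivity
  rw [productArray_succ, productArray_succ_succ]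
  field_simp
  ring

theorem productArray_sub (y : ℝ) (n k : ℕ) :
    productArray y (n + 1) k - productArray y (n + 1) (k + 1) = y * productArray y n k := by
  have hn : (n : ℝ) + 1 ≠ 0 := by positivity
  rw [productArray_succ, productArray_succ_succ]
  field_simp
  ring

theorem productArray_eq_prod_Icc (y : ℝ) (n k : ℕ) :
    productArray y n k = 1 / (n.factorial : ℝ) *
      ∏ i ∈ Icc (-(k : ℤ)) (-(k : ℤ) + (n : ℤ) - 1), (1 + y * (i : ℝ)) := by
  unfold productArray
  congr 1
  refine prod_bij (fun j _ => (j : ℤ) - k) ?_ ?_ ?_ ?_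
  · intro j hj
    simp only [mem_range, mem_Icc] at *
    omega
  · intro a _ b _ h
    simpa using h
  · intro b hb
    simp only [mem_Icc] at hb
    exact ⟨(b + k).toNat, by simp only [mem_range]; omega, by omega⟩
  · intro j _
    push_cast
    ring

theorem productArray_zero (n k : ℕ) : productArray 0 n k = 1 / (n.factorial : ℝ) := by
  simp [productArray]

theorem choose_eq_prod_div (a n : ℕ) :
    (a.choose n : ℝ) = 1 / (n.factorial : ℝ) * ∏ j ∈ range n, ((a : ℝ) - j) := by
  have hf : (n.factorial : ℝ) ≠ 0 := by positivity
  rw [← descPochhammer_eval_eq_prod_range, descPochhammer_eval_eq_descFactorial,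
    Nat.descFactorial_eq_factorial_mul_choose]
  push_cast
  field_simp

theorem productArray_neg_inv (κ n k : ℕ) :
    productArray (-(1 / ((κ : ℝ) + 1))) n k =
      ((κ + k + 1).choose n : ℝ) / ((κ : ℝ) + 1) ^ n := by
  have hκ : (κ : ℝ) + 1 ≠ 0 := by positivity
  rw [choose_eq_prod_div, mul_div_assoc, productArray]
  congr 1
  rw [← card_range n, ← prod_const, card_range, ← prod_div_distrib]
  refine prod_congr rfl fun j _ => ?_
  push_cast
  field_simp
  ring

theorem productArray_inv (κ : ℕ) {n k : ℕ} (hk : k < n) :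
    productArray (1 / ((κ : ℝ) + 1)) n k =
      ((n + κ - k).choose n : ℝ) / ((κ : ℝ) + 1) ^ n := by
  have hκ : (κ : ℝ) + 1 ≠ 0 := by positivity
  rw [choose_eq_prod_div, mul_div_assoc, productArray]
  congr 1
  -- For y > 0 the factors increase with `j`; reversing them gives a falling factorial.
  rw [← prod_range_reflect, ← card_range n, ← prod_const, card_range, ← prod_div_distrib]
  refine prod_congr rfl fun j hj => ?_
  have hj := mem_range.1 hj
  rw [Nat.cast_sub (by omega : k ≤ n + κ), Nat.sub_sub, Nat.cast_sub (by omega : 1 + j ≤ n)]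
  push_cast
  field_simp
  ring

theorem productArray_nonneg {y : ℝ}
    (hy : y = 0 ∨ ∃ κ : ℕ, y = 1 / ((κ : ℝ) + 1) ∨ y = -(1 / ((κ : ℝ) + 1)))
    {n k : ℕ} (hk : k < n) : 0 ≤ productArray y n k := by
  rcases hy with rfl | ⟨κ, rfl | rfl⟩
  · rw [productArray_zero]; positivity
  · rw [productArray_inv κ hk]; positivity
  · rw [productArray_neg_inv]; positivity

theorem eq_inv_of_productArray_nonneg {y : ℝ} (hy : |y| ≤ 1)
    (h : ∀ n k : ℕ, k < n → 0 ≤ productArray y n k) :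
    y = 0 ∨ ∃ κ : ℕ, y = 1 / ((κ : ℝ) + 1) ∨ y = -(1 / ((κ : ℝ) + 1)) := by
  by_cases h0 : y = 0
  · exact Or.inl h0
  right
  have hpos : 0 < |y| := abs_pos.2 h0
  obtain ⟨κ, hκ⟩ : ∃ κ : ℕ, ⌊|y|⁻¹⌋₊ = κ + 1 :=
    Nat.exists_eq_succ_of_ne_zero (Nat.floor_pos.2 ((one_le_inv₀ hpos).2 hy)).ne'
  refine ⟨κ, ?_⟩
  have hle : ((κ : ℝ) + 1) * |y| ≤ 1 := by
    have := Nat.floor_le (inv_nonneg.2 hpos.le)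
    rw [hκ] at this
    push_cast at this
    rwa [le_inv_comm₀ (by positivity) hpos, ← one_div, le_div_iff₀' (by positivity)] at this
  have hlt : 1 < ((κ : ℝ) + 2) * |y| := by
    have := Nat.lt_floor_add_one (|y|⁻¹)
    rw [hκ] at this
    push_cast at this
    rw [inv_lt_comm₀ hpos (by positivity), ← one_div, div_lt_iff₀' (by positivity)] at this
    linarith
  suffices hs : ((κ : ℝ) + 1) * |y| = 1 by
    have : |y| = 1 / ((κ : ℝ) + 1) := by
      rw [eq_div_iff (by positivity)]
      linarith
    exact eq_or_eq_neg_of_abs_eq this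
  by_contra hne
  have hle := lt_of_le_of_ne hle hne
  have hfac : ∀ i : ℕ, i ≤ κ + 1 → 0 < 1 - (i : ℝ) * |y| := fun i hi => by
    have : (i : ℝ) ≤ (κ : ℝ) + 1 := by exact_mod_cast hi
    nlinarith
  -- Since κ + 1 < 1/|y| < κ + 2, a row of length κ + 3 read from the suitable end has exactly one
  -- negative factor, 1 - (κ+2)|y|.
  suffices ∃ n k : ℕ, k < n ∧ productArray y n k < 0 by
    obtain ⟨n, k, hk, hneg⟩ := this
    exact absurd (h n k hk) (not_le.2 hneg)
  rcases lt_or_gt_of_ne h0 with hs | hs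
  · rw [abs_of_neg hs] at hfac hlt
    refine ⟨κ + 3, 0, by omega, ?_⟩
    rw [productArray, prod_range_succ]
    refine mul_neg_of_pos_of_neg (by positivity)
      (mul_neg_of_pos_of_neg (prod_pos fun j hj => ?_) ?_)
    · have := hfac j (by have := mem_range.1 hj; omega)
      push_cast
      linarith
    · push_cast
      linarith
  · rw [abs_of_pos hs] at hfac hlt
    refine ⟨κ + 3, κ + 2, by omega, ?_⟩
    rw [productArray, prod_range_succ']
    refine mul_neg_of_pos_of_neg (by positivity)
      (mul_neg_of_pos_of_neg (prod_pos fun j hj => ?_) ?_)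
    · have hj := mem_range.1 hj
      have := hfac (κ + 1 - j) (by omega)
      rw [Nat.cast_sub (by omega)] at this
      push_cast at this ⊢
      linarith
    · push_cast
      linarith

/-! ### Nonnegative solutions and the difference operator -/

/-- The array of the values of `productArray y`. -/
noncomputable def candidate (y : ℝ) : Arr := fun n k => productArray y n k

/-- The cone of nonnegative solutions of the dual Eulerian recursion. -/
def IsNonnegSolution (V : Arr) : Prop :=
  (∀ (n : ℕ) (k : Fin n), 0 ≤ V n k) ∧
    ∀ (n : ℕ) (k : Fin n),
      V n k = ((k : ℝ) + 1) * V (n + 1) k.castSucc + ((n : ℝ) - (k : ℝ)) * V (n + 1) k.succ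

theorem mem_solutions {V : Arr} : V ∈ solutions ↔ IsNonnegSolution V ∧ V 1 0 = 1 :=
  and_assoc.symm

theorem candidate_mem_solutions {y : ℝ}
    (hy : y = 0 ∨ ∃ κ : ℕ, y = 1 / ((κ : ℝ) + 1) ∨ y = -(1 / ((κ : ℝ) + 1))) :
    candidate y ∈ solutions :=
  ⟨fun _ k => productArray_nonneg hy k.2, fun n k => by
    simpa [candidate] using productArray_recursion y n k, by
    simpa [candidate] using productArray_one_zero y⟩

/-- The differences of neighbouring entries in the next row; it acts on `candidate y` as
multiplication by `y`. -/
def difference (V : Arr) : Arr := fun n k => V (n + 1) k.castSucc - V (n + 1) k.succ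

theorem difference_candidate (y : ℝ) : difference (candidate y) = y • candidate y := by
  funext n k
  simpa [candidate, difference] using productArray_sub y n k

theorem cast_val_add_one_le {n : ℕ} (k : Fin n) : (k : ℝ) + 1 ≤ n := by
  exact_mod_cast k.2

theorem difference_recursion {V : Arr} (hV : IsNonnegSolution V) (n : ℕ) (k : Fin n) :
    difference V n k = ((k : ℝ) + 1) * difference V (n + 1) k.castSucc +
      ((n : ℝ) - (k : ℝ)) * difference V (n + 1) k.succ := by
  have h₁ := hV.2 (n + 1) k.castSucc
  have h₂ := hV.2 (n + 1) k.succ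
  simp only [difference, Fin.succ_castSucc, Fin.val_castSucc, Fin.val_succ] at *
  push_cast at *
  rw [h₁, h₂]
  ring

/-- By the recursion, V + DV has coefficients k + 2 and n - k - 1 on the next row, both nonnegative;
for V - DV they are k and n - k + 1. -/
theorem IsNonnegSolution.add_difference {V : Arr} (hV : IsNonnegSolution V) :
    IsNonnegSolution ((1 / 2 : ℝ) • (V + difference V)) := by
  refine ⟨fun n k => ?_, fun n k => ?_⟩
  · have h₁ := hV.1 (n + 1) k.castSucc
    have h₂ := hV.1 (n + 1) k.succ
    have hk := cast_val_add_one_le k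
    have hk₀ : (0 : ℝ) ≤ k := by positivity
    simp only [Pi.smul_apply, Pi.add_apply, smul_eq_mul, difference, hV.2 n k]
    nlinarith [mul_nonneg (sub_nonneg.2 hk) h₂, mul_nonneg hk₀ h₁]
  · simp only [Pi.smul_apply, Pi.add_apply, smul_eq_mul]
    linear_combination (hV.2 n k + difference_recursion hV n k) / 2

theorem IsNonnegSolution.sub_difference {V : Arr} (hV : IsNonnegSolution V) :
    IsNonnegSolution ((1 / 2 : ℝ) • (V - difference V)) := by
  refine ⟨fun n k => ?_, fun n k => ?_⟩
  · have h₁ := hV.1 (n + 1) k.castSucc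
    have h₂ := hV.1 (n + 1) k.succ
    have hk := cast_val_add_one_le k
    have hk₀ : (0 : ℝ) ≤ k := by positivity
    simp only [Pi.smul_apply, Pi.sub_apply, smul_eq_mul, difference, hV.2 n k]
    nlinarith [mul_nonneg (sub_nonneg.2 hk) h₂, mul_nonneg hk₀ h₁]
  · simp only [Pi.smul_apply, Pi.sub_apply, smul_eq_mul]
    linear_combination (hV.2 n k - difference_recursion hV n k) / 2

theorem IsNonnegSolution.succ_le {V : Arr} (hV : IsNonnegSolution V) (n : ℕ) (k : Fin n) :
    V (n + 1) k.castSucc ≤ V n k ∧ V (n + 1) k.succ ≤ V n k := by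
  have h₁ := hV.1 (n + 1) k.castSucc
  have h₂ := hV.1 (n + 1) k.succ
  have hk := cast_val_add_one_le k
  have hk₀ : (0 : ℝ) ≤ k := by positivity
  rw [hV.2 n k]
  constructor <;> nlinarith [mul_nonneg (sub_nonneg.2 hk) h₂, mul_nonneg hk₀ h₁]

theorem IsNonnegSolution.le_root {V : Arr} (hV : IsNonnegSolution V) (n : ℕ) (k : Fin n) :
    V n k ≤ V 1 0 := by
  induction n with
  | zero => exact k.elim0
  | succ n ih =>
    cases n with
    | zero => rw [Fin.fin_one_eq_zero k]
    | succ n =>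
      induction k using Fin.cases with
      | zero => exact (hV.succ_le (n + 1) 0).1.trans (ih 0)
      | succ k => exact (hV.succ_le (n + 1) k).2.trans (ih k)

theorem IsNonnegSolution.eq_zero {V : Arr} (hV : IsNonnegSolution V) (h : V 1 0 = 0) : V = 0 := by
  funext n k
  exact le_antisymm ((hV.le_root n k).trans_eq h) (hV.1 n k)

theorem IsNonnegSolution.smul {V : Arr} (hV : IsNonnegSolution V) {c : ℝ} (hc : 0 ≤ c) :
    IsNonnegSolution (c • V) := by
  refine ⟨fun n k => mul_nonneg hc (hV.1 n k), fun n k => ?_⟩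
  simp only [Pi.smul_apply, smul_eq_mul]
  linear_combination c * hV.2 n k

/-! ### Extreme solutions are product arrays -/

/-- An extreme solution is proportional to every nonnegative summand of it. -/
theorem eq_smul_of_mem_boundary {V A B : Arr} (hV : V ∈ boundary) (hA : IsNonnegSolution A)
    (hB : IsNonnegSolution B) (hAB : A + B = V) : A = A 1 0 • V := by
  have hroot : A 1 0 + B 1 0 = 1 := by
    rw [← hV.1.2.2, ← hAB]; rfl
  rcases (hA.1 1 0).eq_or_lt with ha | ha
  · rw [hA.eq_zero ha.symm]; simp
  rcases (hB.1 1 0).eq_or_lt with hb | hb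
  · have hB₀ := hB.eq_zero hb.symm
    have hA₁ : A 1 0 = 1 := by linarith
    rw [hA₁, one_smul, ← hAB, hB₀, add_zero]
  have hA' : (A 1 0)⁻¹ • A ∈ solutions :=
    mem_solutions.2 ⟨hA.smul (inv_nonneg.2 ha.le), inv_mul_cancel₀ ha.ne'⟩
  have hB' : (B 1 0)⁻¹ • B ∈ solutions :=
    mem_solutions.2 ⟨hB.smul (inv_nonneg.2 hb.le), inv_mul_cancel₀ hb.ne'⟩
  have hseg : V ∈ openSegment ℝ ((A 1 0)⁻¹ • A) ((B 1 0)⁻¹ • B) :=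
    ⟨A 1 0, B 1 0, ha, hb, hroot, by
      rw [smul_inv_smul₀ ha.ne', smul_inv_smul₀ hb.ne', hAB]⟩
  have := hV.2 hA' hB' hseg
  rw [← this, smul_inv_smul₀ ha.ne']

theorem difference_eq_smul_of_mem_boundary {V : Arr} (hV : V ∈ boundary) :
    difference V = (2 * V 2 0 - 1) • V := by
  have hsol := (mem_solutions.1 hV.1).1
  have h := eq_smul_of_mem_boundary hV hsol.add_difference hsol.sub_difference (by module)
  have hroot : ((1 / 2 : ℝ) • (V + difference V)) 1 0 = V 2 0 := by
    have := hsol.2 1 0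
    simp [difference] at this ⊢
    linarith
  rw [hroot] at h
  have h2 := congrArg (fun A : Arr => (2 : ℝ) • A) h
  simp only [smul_smul] at h2
  norm_num at h2
  rw [sub_smul, ← h2]
  module

/-- The recursion and the eigenvalue equation are two linear equations in two neighbouring entries
of the next row, with determinant ±(n + 1). -/
theorem eq_candidate_of_difference {V : Arr} (hV : V ∈ solutions) {y : ℝ}
    (h : difference V = y • V) : V = candidate y := by
  funext n k
  induction n with
  | zero => exact k.elim0
  | succ n ih =>
    cases n with
    | zero =>
      rw [Fin.fin_one_eq_zero k, hV.2.2]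
      exact (productArray_one_zero y).symm
    | succ n =>
      have hn : (((n + 1 : ℕ) : ℝ)) + 1 ≠ 0 := by positivity
      have key : ∀ j : Fin (n + 1),
          V (n + 1 + 1) j.castSucc = candidate y (n + 1 + 1) j.castSucc ∧
          V (n + 1 + 1) j.succ = candidate y (n + 1 + 1) j.succ := fun j => by
        have h₁ := hV.2.1 (n + 1) j
        have h₂ : V (n + 1 + 1) j.castSucc - V (n + 1 + 1) j.succ = y * V (n + 1) j :=
          congrFun (congrFun h (n + 1)) j
        rw [ih j] at h₁ h₂
        have h₃ := productArray_recursion y (n + 1) j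
        have h₄ := productArray_sub y (n + 1) j
        simp only [candidate, Fin.val_castSucc, Fin.val_succ] at h₁ h₂ ⊢
        constructor
        · refine mul_left_cancel₀ hn ?_
          linear_combination h₃ - h₁ + (((n + 1 : ℕ) : ℝ) - j) * (h₂ - h₄)
        · refine mul_left_cancel₀ hn ?_
          linear_combination h₃ - h₁ - ((j : ℝ) + 1) * (h₂ - h₄)
      induction k using Fin.cases with
      | zero => exact (key 0).1
      | succ k => exact (key k).2

theorem eq_candidate_of_mem_boundary {V : Arr} (hV : V ∈ boundary) :
    V = candidate (2 * V 2 0 - 1) :=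
  eq_candidate_of_difference hV.1 (difference_eq_smul_of_mem_boundary hV)

theorem slope_of_mem_boundary {V : Arr} (hV : V ∈ boundary) :
    2 * V 2 0 - 1 = 0 ∨
      ∃ κ : ℕ, 2 * V 2 0 - 1 = 1 / ((κ : ℝ) + 1) ∨ 2 * V 2 0 - 1 = -(1 / ((κ : ℝ) + 1)) := by
  have hsol := (mem_solutions.1 hV.1).1
  refine eq_inv_of_productArray_nonneg ?_ fun n k hk => ?_
  · have h₀ := hsol.1 2 0
    have h₁ := (hsol.le_root 2 0).trans_eq hV.1.2.2
    rw [abs_le]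
    constructor <;> linarith
  · have := hsol.1 n ⟨k, hk⟩
    rwa [eq_candidate_of_mem_boundary hV] at this

/-! ### Krein–Milman and the extremality of product arrays -/

theorem convex_solutions : Convex ℝ solutions := by
  rintro A ⟨hA₀, hA₁, hA₂⟩ B ⟨hB₀, hB₁, hB₂⟩ a b ha hb hab
  refine ⟨fun n k => add_nonneg (mul_nonneg ha (hA₀ n k)) (mul_nonneg hb (hB₀ n k)),
    fun n k => ?_, ?_⟩
  · simp only [Pi.add_apply, Pi.smul_apply, smul_eq_mul]
    linear_combination a * hA₁ n k + b * hB₁ n k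
  · simp [hA₂, hB₂, hab]

theorem isClosed_solutions : IsClosed solutions := by
  simp only [solutions, Set.ofPred_and, Set.ofPred_forall]
  refine IsClosed.inter ?_ (IsClosed.inter ?_ ?_)
  · exact isClosed_iInter fun n => isClosed_iInter fun k =>
      isClosed_le continuous_const (by fun_prop)
  · exact isClosed_iInter fun n => isClosed_iInter fun k =>
      isClosed_eq (by fun_prop) (by fun_prop)
  · exact isClosed_eq (by fun_prop) continuous_const

theorem isCompact_solutions : IsCompact solutions := by
  refine IsCompact.of_isClosed_subset
    (isCompact_univ_pi fun n => isCompact_univ_pi fun _ : Fin n => isCompact_Icc)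
    isClosed_solutions (?_ : _ ⊆ Set.univ.pi fun n => Set.univ.pi fun _ => Set.Icc (0 : ℝ) 1)
  intro V hV n _ k _
  exact ⟨hV.1 n k, ((mem_solutions.1 hV).1.le_root n k).trans_eq hV.2.2⟩

/-- A variance bound: on extreme solutions the second-order term is `(y' - y) ^ 2`. -/
theorem abs_difference_sub_le {V : Arr} (hV : V ∈ solutions) (y : ℝ) {ε : ℝ} (hε : 0 < ε)
    (n : ℕ) (k : Fin n) :
    |difference V n k - y * V n k| ≤ ε * V 1 0 + 1 / (4 * ε) *
      (difference (difference V) 1 0 - 2 * y * difference V 1 0 + y ^ 2 * V 1 0) := by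
  have hcont : ∀ (n : ℕ) (k : Fin n), Continuous fun V : Arr => difference V n k := fun n k => by
    unfold difference; fun_prop
  have hcont₂ : Continuous fun V : Arr => difference (difference V) 1 0 := by
    unfold difference; fun_prop
  -- For fixed ε the right side is linear in V, so the inequality defines a closed convex set and
  -- need only be checked at extreme points.
  set S : Set Arr := {V | |difference V n k - y * V n k| ≤ ε * V 1 0 + 1 / (4 * ε) *
      (difference (difference V) 1 0 - 2 * y * difference V 1 0 + y ^ 2 * V 1 0)} with hS
  have hclosed : IsClosed S := by
    have h₁ := hcont n k
    have h₂ := hcont 1 0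
    exact isClosed_le (by fun_prop) (by fun_prop)
  have hconv : Convex ℝ S := by
    intro A hA B hB a b ha hb hab
    simp only [hS, Set.mem_ofPred_eq, abs_le] at hA hB ⊢
    simp only [difference, Pi.add_apply, Pi.smul_apply, smul_eq_mul] at hA hB ⊢
    have hA₁ := mul_le_mul_of_nonneg_left hA.1 ha
    have hA₂ := mul_le_mul_of_nonneg_left hA.2 ha
    have hB₁ := mul_le_mul_of_nonneg_left hB.1 hb
    have hB₂ := mul_le_mul_of_nonneg_left hB.2 hb
    constructor <;> linarith
  have hext : boundary ⊆ S := by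
    intro W hW
    have hd := difference_eq_smul_of_mem_boundary hW
    set z := 2 * W 2 0 - 1
    have hdd : difference (z • W) = z • difference W := by
      funext n k
      simp only [difference, Pi.smul_apply, smul_eq_mul]
      ring
    have hW₀ := hW.1.1 n k
    have hW₁ := ((mem_solutions.1 hW.1).1.le_root n k).trans_eq hW.1.2.2
    simp only [hS, Set.mem_ofPred_eq, hd, hdd, Pi.smul_apply, smul_eq_mul, hW.1.2.2]
    rw [← sub_mul, abs_mul, abs_of_nonneg hW₀]
    have h₁ : |z - y| * W n k ≤ |z - y| := mul_le_of_le_one_right (abs_nonneg _) hW₁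
    -- AM-GM: t ≤ ε + t²/(4ε) with t = |z - y|.
    have h₂ : ε * 1 + 1 / (4 * ε) * (z * (z * 1) - 2 * y * (z * 1) + y ^ 2 * 1) - |z - y| =
        1 / (4 * ε) * (|z - y| - 2 * ε) ^ 2 := by
      rw [show z * (z * 1) - 2 * y * (z * 1) + y ^ 2 * 1 = |z - y| ^ 2 by rw [sq_abs]; ring]
      field_simp
      ring
    have h₃ : 0 ≤ 1 / (4 * ε) * (|z - y| - 2 * ε) ^ 2 := by positivity
    linarith
  have hKM := closure_convexHull_extremePoints isCompact_solutions convex_solutions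
  rw [← hKM] at hV
  exact closure_minimal (convexHull_min hext hconv) hclosed hV

theorem second_moment_nonneg {V : Arr} (hV : V ∈ solutions) (y : ℝ) :
    0 ≤ difference (difference V) 1 0 - 2 * y * difference V 1 0 + y ^ 2 * V 1 0 := by
  set Q := difference (difference V) 1 0 - 2 * y * difference V 1 0 + y ^ 2 * V 1 0
  by_contra! hQ
  have hε : 0 < -Q := by linarith
  -- With ε ≤ 1 and ε ≤ -Q/8, the bound is at most -Q/8 + Q/4 < 0.
  have hε' : 0 < min 1 (-Q / 8) := by positivity
  have h : 0 ≤ min 1 (-Q / 8) * V 1 0 + 1 / (4 * min 1 (-Q / 8)) * Q :=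
    (abs_nonneg _).trans (abs_difference_sub_le hV y hε' 1 0)
  rw [hV.2.2] at h
  have h₁ : min 1 (-Q / 8) ≤ 1 := min_le_left _ _
  have h₂ : min 1 (-Q / 8) ≤ -Q / 8 := min_le_right _ _
  have h₃ : 1 / (4 * min 1 (-Q / 8)) ≥ 1 / 4 :=
    one_div_le_one_div_of_le (by positivity) (by linarith)
  have h₄ : 1 / (4 * min 1 (-Q / 8)) * Q ≤ 1 / 4 * Q :=
    mul_le_mul_of_nonpos_right h₃ hQ.le
  linarith

/-- When the second moment vanishes, the variance bound is just ε, and ε → 0 gives DV = yV. -/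
theorem eq_candidate_of_second_moment {V : Arr} (hV : V ∈ solutions) {y : ℝ}
    (h : difference (difference V) 1 0 - 2 * y * difference V 1 0 + y ^ 2 * V 1 0 = 0) :
    V = candidate y := by
  refine eq_candidate_of_difference hV ?_
  funext n k
  refine sub_eq_zero.1 (abs_nonpos_iff.1 (le_of_forall_pos_le_add fun ε hε => ?_))
  have := abs_difference_sub_le hV y hε n k
  rw [h, hV.2.2] at this
  simpa using this

/-- The second moment is linear, nonnegative on solutions and zero here, so it vanishes on both ends
of any segment through this array. -/
theorem candidate_mem_boundary {y : ℝ}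
    (hy : y = 0 ∨ ∃ κ : ℕ, y = 1 / ((κ : ℝ) + 1) ∨ y = -(1 / ((κ : ℝ) + 1))) :
    candidate y ∈ boundary := by
  refine ⟨candidate_mem_solutions hy, ?_⟩
  rintro A hA B hB ⟨a, b, ha, hb, hab, heq⟩
  have hQA := second_moment_nonneg hA y
  have hQB := second_moment_nonneg hB y
  refine eq_candidate_of_second_moment hA (le_antisymm ?_ hQA)
  have hdd : difference (y • candidate y) = y • difference (candidate y) := by
    funext n k
    simp only [difference, Pi.smul_apply, smul_eq_mul]
    ring
  have h : difference (difference (candidate y)) 1 0 - 2 * y * difference (candidate y) 1 0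
      + y ^ 2 * candidate y 1 0 = 0 := by
    rw [difference_candidate, hdd, difference_candidate]
    simp only [Pi.smul_apply, smul_eq_mul]
    ring
  rw [← heq] at h
  simp only [difference, Pi.add_apply, Pi.smul_apply, smul_eq_mul] at h hQA hQB ⊢
  have hB' := mul_nonneg hb.le hQB
  refine le_of_mul_le_mul_left ?_ ha
  linarith

/-! ### From eigenvalues to the parameter θ -/

theorem mem_parameters_iff {θ : ℝ} :
    θ ∈ parameters ↔ 2 * θ - 1 = 0 ∨
      ∃ κ : ℕ, 2 * θ - 1 = 1 / ((κ : ℝ) + 1) ∨ 2 * θ - 1 = -(1 / ((κ : ℝ) + 1)) := by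
  have hpos : ∀ κ : ℕ, (κ : ℝ) + 1 ≠ 0 := fun κ => by positivity
  have h₁ : ∀ κ : ℕ, (κ : ℝ) / (2 * ((κ : ℝ) + 1)) = θ ↔
      2 * θ - 1 = -(1 / ((κ : ℝ) + 1)) := fun κ => by
    have := hpos κ
    rw [show (κ : ℝ) / (2 * ((κ : ℝ) + 1)) = (1 - 1 / ((κ : ℝ) + 1)) / 2 by field_simp; ring]
    constructor <;> intro h <;> linarith
  have h₂ : ∀ κ : ℕ, ((κ : ℝ) + 2) / (2 * ((κ : ℝ) + 1)) = θ ↔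
      2 * θ - 1 = 1 / ((κ : ℝ) + 1) := fun κ => by
    have := hpos κ
    rw [show ((κ : ℝ) + 2) / (2 * ((κ : ℝ) + 1)) = (1 + 1 / ((κ : ℝ) + 1)) / 2 by
      field_simp; ring]
    constructor <;> intro h <;> linarith
  have h₃ : θ = 1 / 2 ↔ 2 * θ - 1 = 0 := by
    constructor <;> intro h <;> linarith
  simp only [parameters, Set.mem_union, Set.mem_range, Set.mem_singleton_iff, h₁, h₂, h₃,
    exists_or]
  tauto

theorem candidate_two_zero (θ : ℝ) : candidate (2 * θ - 1) 2 0 = θ := by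
  have := productArray_two_zero (2 * θ - 1)
  simp only [candidate, Fin.val_zero]
  linarith

end EulerianBoundary

theorem theorem2 :
    -- the extreme solutions are parametrized by `θ = W 2 0`
    Set.BijOn (fun W : EulerianBoundary.Arr => W 2 0)
      EulerianBoundary.boundary EulerianBoundary.parameters ∧
    ∀ W ∈ EulerianBoundary.boundary,
      (∀ κ : ℕ, W 2 0 = ((κ : ℝ) + 2) / (2 * ((κ : ℝ) + 1)) →
        ∀ (n : ℕ) (k : Fin n),
          W n k = (Nat.choose (n + κ - (k : ℕ)) n : ℝ) / ((κ : ℝ) + 1) ^ n) ∧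
      (∀ κ : ℕ, W 2 0 = (κ : ℝ) / (2 * ((κ : ℝ) + 1)) →
        ∀ (n : ℕ) (k : Fin n),
          W n k = (Nat.choose (κ + (k : ℕ) + 1) n : ℝ) / ((κ : ℝ) + 1) ^ n) ∧
      (W 2 0 = 1 / 2 →
        ∀ (n : ℕ) (k : Fin n), W n k = 1 / (Nat.factorial n : ℝ)) ∧
      (∀ (n : ℕ) (k : Fin n),
        W n k = 1 / (Nat.factorial n : ℝ) *
          ∏ i ∈ Finset.Icc (-((k : ℕ) : ℤ)) (-((k : ℕ) : ℤ) + (n : ℤ) - 1),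
            (1 + (2 * W 2 0 - 1) * (i : ℝ))) := by
  open EulerianBoundary in
  refine ⟨⟨fun W hW => mem_parameters_iff.2 (slope_of_mem_boundary hW), ?_, ?_⟩, ?_⟩
  · intro V hV W hW h
    have h : V 2 0 = W 2 0 := h
    rw [eq_candidate_of_mem_boundary hV, eq_candidate_of_mem_boundary hW, h]
  · intro θ hθ
    exact ⟨candidate (2 * θ - 1), candidate_mem_boundary (mem_parameters_iff.1 hθ),
      candidate_two_zero θ⟩
  · intro W hW
    have key : ∀ (n : ℕ) (k : Fin n), W n k = productArray (2 * W 2 0 - 1) n k := fun n k =>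
      congrFun (congrFun (eq_candidate_of_mem_boundary hW) n) k
    refine ⟨fun κ h n k => ?_, fun κ h n k => ?_, fun h n k => ?_, fun n k => ?_⟩
    · have hκ : (κ : ℝ) + 1 ≠ 0 := by positivity
      rw [key, h, ← productArray_inv κ k.2]
      congr 1
      field_simp
      ring
    · have hκ : (κ : ℝ) + 1 ≠ 0 := by positivity
      rw [key, h, ← productArray_neg_inv]
      congr 1
      field_simp
      ring
    · rw [key, h, ← productArray_zero n k]
      norm_num
    · rw [key, productArray_eq_prod_Icc]
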